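/- Let $(a_i)_{i\ge1}$ and $(b_i)_{i\ge1}$ be strictly positive real sequences with $\sum_{i\ge1}a_i+\sum_{i\ge1}b_i=1$, and put $b_0=0$. Write $\mathbb N=\{1,2,3,\dots\}$ and let $\varpi$ be the probability distribution on $\mathbb N\times\mathbb N$ with density (with respect to counting measure) $$\pi(x,y)=\begin{cases}a_x & x=y,\\ b_y & x=y+1,\\ 0&\text{otherwise.}\end{cases}$$ Let $\pi_X(x)=\sum_y\pi(x,y)$ and $\pi_Y(y)=\sum_x\pi(x,y)$ be the marginal densities, $\varpi_X$ the distribution with density $\pi_X$, and $\pi_{X|Y}(x|y)=\pi(x,y)/\pi_Y(y)$, $\pi_{Y|X}(y|x)=\pi(x,y)/\pi_X(x)$ the conditional densities. Fix $\theta\in(0,1)$ and consider the Markov chains with the following transition densities (with respect to counting measure, $\delta$ being the Kronecker delta): - the $X$-marginal chain $\Phi_X$ on $\mathbb N$: $k_X(x'|x)=\sum_{y}\pi_{X|Y}(x'|y)\,\pi_{Y|X}(y|x)$; - the deterministic scan Gibbs sampler $\Phi_{DGS}$ on $\mathbb N\times\mathbb N$: $k_{DGS}(x',y'|x,y)=\pi_{X|Y}(x'|y)\,\pi_{Y|X}(y'|x')$;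 - the random scan Gibbs sampler $\Phi_{RGS}$ on $\mathbb N\times\mathbb N$: $k_{RGS}(x',y'|x,y)=\theta\,\pi_{X|Y}(x'|y)\,\delta(y'-y)+(1-\theta)\,\pi_{Y|X}(y'|x)\,\delta(x'-x)$. A Markov kernel $P$ on a space $\mathsf Z$ with invariant probability measure $w$ is called geometrically ergodic if there are a function $M:\mathsf Z\to\mathbb R$ and $t\in(0,1)$ such that $\|P^n(z,\cdot)-w\|_{TV}\le M(z)\,t^n$ for all $z\in\mathsf Z$ and all $n$. Set, for $x\ge 2$, $$p_x=\frac{a_xb_x}{(a_x+b_{x-1})(a_x+b_x)},\qquad q_x=\frac{a_{x-1}b_{x-1}}{(a_x+b_{x-1})(a_{x-1}+b_{x-1})}.$$ If $\limsup_{x\to\infty}p_x/q_x<1$ and $\liminf_{x\to\infty}q_x>0$, then $\Phi_X$ (with invariant distribution $\varpi_X$), $\Phi_{DGS}$ and $\Phi_{RGS}$ (both with invariant distribution $\varpi$) are geometrically ergodic. -/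

import Mathlib

open MeasureTheory ProbabilityTheory Filter
open scoped ENNReal

noncomputable section

namespace Gibbs

/-- The positive integers carry the discrete sigma-algebra. -/
instance : MeasurableSpace ℕ+ := ⊤

instance : DiscreteMeasurableSpace ℕ+ := ⟨fun _ => trivial⟩

/-! ### Geometric ergodicity -/

/-- Total variation distance `sup_A |μ A - ν A|` between two finite measures. (Twice this number
is the total mass of `|μ - ν|` when both are probability measures.) -/
def tvDist {Z : Type*} [MeasurableSpace Z] (μ ν : Measure Z) : ℝ :=
  ⨆ A : {A : Set Z // MeasurableSet A}, |μ.real A.1 - ν.real A.1|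

/-- The Markov kernel `P`, with invariant probability measure `w`, is geometrically ergodic:
there are a real-valued function `M` and `0 < t < 1` with `‖P^n(z, ·) - w‖ ≤ M(z) t^n` for
every starting point `z` and every `n`. Here `P ^ n` is the `n`-fold composition of kernels. -/
structure GeometricallyErgodic {Z : Type*} [MeasurableSpace Z] (P : Kernel Z Z) (w : Measure Z) :
    Prop where
  isMarkov : IsMarkovKernel P
  isProbability : IsProbabilityMeasure w
  invariant : P.Invariant w
  rate : ∃ (M : Z → ℝ) (t : ℝ), 0 < t ∧ t < 1 ∧
    ∀ (z : Z) (n : ℕ), tvDist ((P ^ n) z) w ≤ M z * t ^ n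

/-! ### Measures and kernels given by densities with respect to counting measure -/

/-- The measure with density `f` with respect to counting measure. -/
def densityMeasure {S : Type*} [MeasurableSpace S] (f : S → ℝ) : Measure S :=
  Measure.count.withDensity fun s => ENNReal.ofReal (f s)

/-- The kernel whose value at `z` has density `k · z` with respect to counting measure:
`k z' z` is the density of moving from `z` to `z'`. -/
def densityKernel {S : Type*} [MeasurableSpace S] [DiscreteMeasurableSpace S] [Countable S]
    (k : S → S → ℝ) : Kernel S S :=
  Kernel.ofFunOfCountable fun z => densityMeasure fun z' => k z' z

/-! ### Two-variable Gibbs samplers for a density `π` on `ℕ+ × ℕ+` -/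

/-- Marginal density of the first coordinate. -/
def margX (π : ℕ+ → ℕ+ → ℝ) (x : ℕ+) : ℝ := ∑' y : ℕ+, π x y

/-- Marginal density of the second coordinate. -/
def margY (π : ℕ+ → ℕ+ → ℝ) (y : ℕ+) : ℝ := ∑' x : ℕ+, π x y

/-- Conditional density `π_{X|Y}(x | y)`. -/
def condX (π : ℕ+ → ℕ+ → ℝ) (x y : ℕ+) : ℝ := π x y / margY π y

/-- Conditional density `π_{Y|X}(y | x)`. -/
def condY (π : ℕ+ → ℕ+ → ℝ) (y x : ℕ+) : ℝ := π x y / margX π x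

/-- The joint distribution. -/
def jointLaw (π : ℕ+ → ℕ+ → ℝ) : Measure (ℕ+ × ℕ+) := densityMeasure fun z => π z.1 z.2

/-- The marginal distribution of the first coordinate. -/
def margLawX (π : ℕ+ → ℕ+ → ℝ) : Measure ℕ+ := densityMeasure (margX π)

/-- Transition density of the `X`-marginal chain,
`k_X(x' | x) = ∑_y π_{X|Y}(x' | y) π_{Y|X}(y | x)`. -/
def kX (π : ℕ+ → ℕ+ → ℝ) (x' x : ℕ+) : ℝ := ∑' y : ℕ+, condX π x' y * condY π y x

/-- Transition density of the deterministic scan Gibbs sampler,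
`k_DGS(x', y' | x, y) = π_{X|Y}(x' | y) π_{Y|X}(y' | x')`. -/
def kDGS (π : ℕ+ → ℕ+ → ℝ) (z' z : ℕ+ × ℕ+) : ℝ := condX π z'.1 z.2 * condY π z'.2 z'.1

/-- Transition density of the random scan Gibbs sampler with selection probability `θ`,
`θ π_{X|Y}(x' | y) δ(y' - y) + (1 - θ) π_{Y|X}(y' | x) δ(x' - x)`; with respect to counting
measure the delta function is the Kronecker delta. -/
def kRGS (π : ℕ+ → ℕ+ → ℝ) (θ : ℝ) (z' z : ℕ+ × ℕ+) : ℝ :=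
  θ * condX π z'.1 z.2 * (if z'.2 = z.2 then 1 else 0)
    + (1 - θ) * condY π z'.2 z.1 * (if z'.1 = z.1 then 1 else 0)

/-- Kernel of the `X`-marginal chain. -/
def PX (π : ℕ+ → ℕ+ → ℝ) : Kernel ℕ+ ℕ+ := densityKernel (kX π)

/-- Kernel of the deterministic scan Gibbs sampler. -/
def PDGS (π : ℕ+ → ℕ+ → ℝ) : Kernel (ℕ+ × ℕ+) (ℕ+ × ℕ+) := densityKernel (kDGS π)

/-- Kernel of the random scan Gibbs sampler with selection probability `θ`. -/
def PRGS (π : ℕ+ → ℕ+ → ℝ) (θ : ℝ) : Kernel (ℕ+ × ℕ+) (ℕ+ × ℕ+) := densityKernel (kRGS π θ)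

/-! ### The discrete family

The sequences are functions on `ℕ`; the value `a 0` is never used (it only occurs multiplied by
`b 0 = 0`), and `b 0 = 0` is a convention imposed in the theorem. -/

/-- The density `π(x, x) = a_x`, `π(y + 1, y) = b_y`, and `0` elsewhere. -/
def familyDensity (a b : ℕ → ℝ) (x y : ℕ+) : ℝ :=
  if x = y then a x else if x = y + 1 then b y else 0

/-- `p_x = a_x b_x / ((a_x + b_{x-1}) (a_x + b_x))`, for `x ≥ 1`. -/
def pSeq (a b : ℕ → ℝ) (x : ℕ) : ℝ :=
  a x * b x / ((a x + b (x - 1)) * (a x + b x))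

/-- `q_x = a_{x-1} b_{x-1} / ((a_x + b_{x-1}) (a_{x-1} + b_{x-1}))`, for `x ≥ 1`. -/
def qSeq (a b : ℕ → ℝ) (x : ℕ) : ℝ :=
  a (x - 1) * b (x - 1) / ((a x + b (x - 1)) * (a (x - 1) + b (x - 1)))

end Gibbs

end

/-! The support of `familyDensity` is an infinite path (1,1), (2,1), (2,2), (3,2), … with weights
a₁, b₁, a₂, b₂, …. Conditioning on Y averages over the pairs (aᵢ, bᵢ), and conditioning on X
averages over the pairs (bᵢ, aᵢ₊₁), the vertex (1,1) being left alone. Averaging a pair of weights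
s, t destroys exactly st/(s+t) times the squared difference of the two values. So the energy lost by
the two conditional expectations together is the Dirichlet form of the path with these conductances.

The two hypotheses concern cᵢ = aᵢbᵢ/(aᵢ+bᵢ): p_x/q_x is c_x/c_{x-1}, and q_x is
c_{x-1}/(a_x+b_{x-1}). They say that cᵢ eventually decays geometrically and dominates aᵢ₊₁+bᵢ, so
the mass beyond any vertex is at most a constant times the mass of that vertex
(`exists_tailMass_le`). A Hardy-type argument turns this into a Poincaré inequality
(`path_poincare`), that is, the energy of a centred function is at most K times the energy lost
(`exists_spectral_bound`).

Each sampler is built from the two conditional expectations, so this gives an L² contraction on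
centred functions. Atoms have positive mass, which turns L² bounds into pointwise ones;
`geometricallyErgodic_of_contraction` then applied to centred indicators yields total variation
decay. -/

namespace Gibbs

/-! ### From quadratic contraction to total variation decay -/

section Contraction

variable {Z : Type*} [MeasurableSpace Z]

/-- A real function with bounded absolute value. -/
def IsBdd {S : Type*} (f : S → ℝ) : Prop := ∃ B : ℝ, ∀ z, |f z| ≤ B

theorem IsBdd.integrable [DiscreteMeasurableSpace Z] {f : Z → ℝ} (hf : IsBdd f) (μ : Measure Z) [IsFiniteMeasure μ] :
    Integrable f μ := by
  obtain ⟨B, hB⟩ := hf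
  exact Integrable.of_bound (Measurable.of_discrete.aestronglyMeasurable) B
    (Eventually.of_forall hB)

theorem abs_integral_le_of_abs_le {μ : Measure Z} [IsProbabilityMeasure μ] {f : Z → ℝ} {B : ℝ}
    (hB : ∀ z, |f z| ≤ B) : |∫ z, f z ∂μ| ≤ B := by
  have := norm_integral_le_of_norm_le_const (μ := μ) (f := f) (C := B) (Eventually.of_forall hB)
  simpa using this

/-- The action of a kernel on functions. -/
noncomputable def avg (P : Kernel Z Z) (f : Z → ℝ) (z : Z) : ℝ := ∫ y, f y ∂(P z)

instance isMarkovKernel_pow (P : Kernel Z Z) [IsMarkovKernel P] (n : ℕ) :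
    IsMarkovKernel (P ^ n) := by
  induction n with
  | zero => rw [pow_zero]; exact inferInstanceAs (IsMarkovKernel Kernel.id)
  | succ n ih => rw [Kernel.pow_add, pow_one]; infer_instance

theorem IsBdd.avg {P : Kernel Z Z} [IsMarkovKernel P] {f : Z → ℝ} (hf : IsBdd f) :
    IsBdd (avg P f) := by
  obtain ⟨B, hB⟩ := hf
  exact ⟨B, fun z => abs_integral_le_of_abs_le hB⟩

variable [DiscreteMeasurableSpace Z]

theorem avg_pow_succ (P : Kernel Z Z) [IsMarkovKernel P] {f : Z → ℝ} (hf : IsBdd f) (n : ℕ) :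
    avg (P ^ (n + 1)) f = avg P (avg (P ^ n) f) := by
  funext z
  unfold avg
  rw [Kernel.pow_add, pow_one]
  exact Kernel.integral_comp (hf.integrable _)

theorem invariant_of_integral {P : Kernel Z Z} [IsMarkovKernel P] {w : Measure Z}
    [IsProbabilityMeasure w] (h : ∀ f, IsBdd f → ∫ z, avg P f z ∂w = ∫ z, f z ∂w) :
    P.Invariant w := by
  ext A hA
  rw [Measure.bind_apply hA P.measurable.aemeasurable]
  have hb : IsBdd (A.indicator (1 : Z → ℝ)) :=
    ⟨1, fun z => by by_cases hz : z ∈ A <;> simp [hz]⟩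
  have h1 := h _ hb
  rw [integral_indicator_one hA] at h1
  have h2 : ∀ z, avg P (A.indicator (1 : Z → ℝ)) z = ((P z) A).toReal := fun z =>
    integral_indicator_one hA
  simp only [h2] at h1
  rw [integral_toReal Measurable.of_discrete.aemeasurable
    (Eventually.of_forall fun z => measure_lt_top _ _), measureReal_def] at h1
  refine (ENNReal.toReal_eq_toReal_iff' ?_ (measure_ne_top _ _)).1 h1
  refine ne_top_of_le_ne_top (b := 1) ENNReal.one_ne_top ?_
  calc ∫⁻ z, (P z) A ∂w ≤ ∫⁻ _, 1 ∂w := lintegral_mono fun z => prob_le_one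
    _ = 1 := by simp

/-- A Markov kernel that contracts a quadratic functional of centred bounded functions, where the
functional controls the kernel averages pointwise, is geometrically ergodic. -/
theorem geometricallyErgodic_of_contraction (P : Kernel Z Z) [IsMarkovKernel P] (w : Measure Z)
    [IsProbabilityMeasure w] (N : (Z → ℝ) → ℝ) (M : Z → ℝ) (s B : ℝ) (hs0 : 0 < s) (hs1 : s < 1)
    (hM : ∀ z, 0 ≤ M z)
    (hinv : ∀ f, IsBdd f → ∫ z, avg P f z ∂w = ∫ z, f z ∂w)
    (hcontr : ∀ f, IsBdd f → ∫ z, f z ∂w = 0 → N (avg P f) ≤ s * N f)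
    (hpt : ∀ f, IsBdd f → ∀ z, (avg P f z) ^ 2 ≤ M z * N f)
    (hB : ∀ f : Z → ℝ, (∀ z, |f z| ≤ 1) → N f ≤ B) :
    GeometricallyErgodic P w := by
  have hB0 : ∀ z, 0 ≤ M z * B := fun z => by
    have h0 := hpt (fun _ => 0) ⟨0, by simp⟩ z
    have h1 := mul_le_mul_of_nonneg_left (hB (fun _ => 0) (by simp)) (hM z)
    have h2 := sq_nonneg (avg P (fun _ => 0) z)
    linarith
  have hpow : ∀ (f : Z → ℝ), (∀ z, |f z| ≤ 1) → ∫ z, f z ∂w = 0 → ∀ n,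
      IsBdd (avg (P ^ n) f) ∧ ∫ z, avg (P ^ n) f z ∂w = 0 ∧
        N (avg (P ^ n) f) ≤ s ^ n * B := by
    intro f hf1 hf0 n
    have hf : IsBdd f := ⟨1, hf1⟩
    induction n with
    | zero =>
      have : avg (P ^ 0) f = f := by
        funext z
        rw [pow_zero]
        change ∫ y, f y ∂(Kernel.id z) = f z
        simp [Kernel.id_apply]
      rw [this]
      exact ⟨hf, hf0, by simpa using hB f hf1⟩
    | succ n ih =>
      obtain ⟨h1, h2, h3⟩ := ih
      rw [avg_pow_succ P hf]
      refine ⟨h1.avg, by rw [hinv _ h1, h2], (hcontr _ h1 h2).trans ?_⟩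
      rw [pow_succ', mul_assoc]
      gcongr
  -- `N` is quadratic, so the rate is `√s`. The pointwise bound spends one application of `P`, so `n
  -- + 1` steps give only `s ^ n`; this accounts for the division by `√s`. The summand 1 covers `n =
  -- 0`.
  refine ⟨inferInstance, inferInstance, invariant_of_integral hinv,
    fun z => 1 + √(M z * B) / √s, √s, Real.sqrt_pos.2 hs0, ?_, ?_⟩
  · rw [Real.sqrt_lt' one_pos]; simpa using hs1
  intro z n
  have hK0 : 0 ≤ √(M z * B) / √s := by positivity
  refine ciSup_le fun A => ?_
  have hA := A.2
  -- The average of the centred indicator under `P ^ n` is the discrepancy of the two measures on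
  -- `A`.
  set f : Z → ℝ := fun y => A.1.indicator 1 y - w.real A.1 with hfdef
  have hind : IsBdd (A.1.indicator (1 : Z → ℝ)) :=
    ⟨1, fun z => by by_cases hz : z ∈ A.1 <;> simp [hz]⟩
  have hw0 : 0 ≤ w.real A.1 := measureReal_nonneg
  have hw1 : w.real A.1 ≤ 1 := measureReal_le_one
  have hf1 : ∀ y, |f y| ≤ 1 := fun y => by
    rw [abs_le]
    by_cases hy : y ∈ A.1 <;> simp only [hfdef, hy, Set.indicator_of_mem,
      Set.indicator_of_notMem, not_false_eq_true, Pi.one_apply] <;> constructor <;> linarith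
  have hint : ∀ (μ : Measure Z) [IsProbabilityMeasure μ],
      ∫ y, f y ∂μ = μ.real A.1 - w.real A.1 := fun μ _ => by
    rw [integral_sub (hind.integrable _) (integrable_const _), integral_indicator_one hA]
    simp
  have hf0 : ∫ y, f y ∂w = 0 := by rw [hint, sub_self]
  have hval : ((P ^ n) z).real A.1 - w.real A.1 = avg (P ^ n) f z := (hint _).symm
  rw [hval]
  cases n with
  | zero =>
    rw [pow_zero (√s), mul_one]
    refine (abs_integral_le_of_abs_le hf1).trans ?_
    linarith
  | succ n =>
    obtain ⟨h1, -, h3⟩ := hpow f hf1 hf0 n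
    rw [avg_pow_succ P ⟨1, hf1⟩]
    have h4 : (avg P (avg (P ^ n) f) z) ^ 2 ≤ s ^ n * (M z * B) := by
      refine (hpt _ h1 z).trans ((mul_le_mul_of_nonneg_left h3 (hM z)).trans_eq ?_)
      ring
    have hsq : √(s ^ n * (M z * B)) = √s ^ n * √(M z * B) := by
      have h5 : s ^ n = (√s ^ n) ^ 2 := by rw [← pow_mul, mul_comm, pow_mul, Real.sq_sqrt hs0.le]
      rw [Real.sqrt_mul (by positivity), h5, Real.sqrt_sq (by positivity)]
    refine (Real.abs_le_sqrt h4).trans ?_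
    rw [hsq]
    have hs' : 0 < √s := Real.sqrt_pos.2 hs0
    have : (1 + √(M z * B) / √s) * √s ^ (n + 1)
        = √s ^ (n + 1) + √s ^ n * √(M z * B) := by
      rw [pow_succ]; field_simp
    rw [this]
    have : 0 ≤ √s ^ (n + 1) := by positivity
    linarith

end Contraction

/-! ### Integration against densities -/

section Density

variable {S : Type*} [MeasurableSpace S] [DiscreteMeasurableSpace S] [Countable S]

theorem densityMeasure_univ {f : S → ℝ} (h0 : ∀ s, 0 ≤ f s) (hf : Summable f) :
    densityMeasure f Set.univ = ENNReal.ofReal (∑' s, f s) := by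
  rw [densityMeasure, withDensity_apply _ MeasurableSet.univ, Measure.restrict_univ,
    lintegral_count, ENNReal.ofReal_tsum_of_nonneg h0 hf]

theorem isProbabilityMeasure_densityMeasure {f : S → ℝ} (h0 : ∀ s, 0 ≤ f s) (hf : HasSum f 1) :
    IsProbabilityMeasure (densityMeasure f) :=
  ⟨by rw [densityMeasure_univ h0 hf.summable, hf.tsum_eq, ENNReal.ofReal_one]⟩

theorem integral_densityMeasure {f : S → ℝ} (h0 : ∀ s, 0 ≤ f s) (hf : Summable f) {g : S → ℝ}
    (hg : IsBdd g) : ∫ s, g s ∂(densityMeasure f) = ∑' s, f s * g s := by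
  have : IsFiniteMeasure (densityMeasure f) :=
    ⟨by rw [densityMeasure_univ h0 hf]; exact ENNReal.ofReal_lt_top⟩
  rw [integral_countable (hg.integrable _)]
  refine tsum_congr fun s => ?_
  rw [measureReal_def, densityMeasure, withDensity_apply _ (measurableSet_singleton s)]
  simp [h0 s]

end Density

/-! ### A Poincaré inequality on a weighted half-line path -/

section Path

theorem IsBdd.summable_mul {ι : Type*} {c g : ι → ℝ} (hg : IsBdd g) (h0 : ∀ i, 0 ≤ c i)
    (hc : Summable c) : Summable fun i => c i * g i := by
  obtain ⟨B, hB⟩ := hg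
  refine Summable.of_norm_bounded (hc.mul_right B) fun i => ?_
  rw [Real.norm_eq_abs, abs_mul, abs_of_nonneg (h0 i)]
  exact mul_le_mul_of_nonneg_left (hB i) (h0 i)

theorem IsBdd.sq {ι : Type*} {g : ι → ℝ} (hg : IsBdd g) : IsBdd fun i => g i ^ 2 := by
  obtain ⟨B, hB⟩ := hg
  refine ⟨B ^ 2, fun i => ?_⟩
  rw [abs_pow]
  exact pow_le_pow_left₀ (abs_nonneg _) (hB i) 2

theorem IsBdd.sub {ι : Type*} {g h : ι → ℝ} (hg : IsBdd g) (hh : IsBdd h) :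
    IsBdd fun i => g i - h i := by
  obtain ⟨B, hB⟩ := hg
  obtain ⟨C, hC⟩ := hh
  exact ⟨B + C, fun i => (abs_sub _ _).trans (add_le_add (hB i) (hC i))⟩

theorem IsBdd.add {ι : Type*} {g h : ι → ℝ} (hg : IsBdd g) (hh : IsBdd h) :
    IsBdd fun i => g i + h i := by
  obtain ⟨B, hB⟩ := hg
  obtain ⟨C, hC⟩ := hh
  exact ⟨B + C, fun i => (abs_add_le _ _).trans (add_le_add (hB i) (hC i))⟩

theorem IsBdd.const_mul {ι : Type*} {g : ι → ℝ} (hg : IsBdd g) (c : ℝ) :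
    IsBdd fun i => c * g i := by
  obtain ⟨B, hB⟩ := hg
  exact ⟨|c| * B, fun i => by rw [abs_mul]; gcongr; exact hB i⟩

theorem IsBdd.comp {ι κ : Type*} {g : ι → ℝ} (hg : IsBdd g) (φ : κ → ι) :
    IsBdd fun i => g (φ i) := by
  obtain ⟨B, hB⟩ := hg
  exact ⟨B, fun i => hB _⟩

/-- The conductance of two weights. -/
noncomputable def conductance (s t : ℝ) : ℝ := s * t / (s + t)

theorem conductance_nonneg {s t : ℝ} (hs : 0 < s) (ht : 0 < t) : 0 ≤ conductance s t := by
  unfold conductance; positivity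

theorem conductance_le_left {s t : ℝ} (hs : 0 < s) (ht : 0 < t) : conductance s t ≤ s := by
  unfold conductance
  rw [div_le_iff₀ (by positivity)]
  nlinarith

theorem conductance_le_right {s t : ℝ} (hs : 0 < s) (ht : 0 < t) : conductance s t ≤ t := by
  unfold conductance
  rw [div_le_iff₀ (by positivity)]
  nlinarith

/-- The mass of the pairs `(a j, b j)` with `j ≥ i`. -/
noncomputable def tailMass (a b : ℕ → ℝ) (i : ℕ) : ℝ := ∑' j, (a (i + j) + b (i + j))

section Tail

variable {a b : ℕ → ℝ}

theorem tailMass_eq (hsa : Summable a) (hsb : Summable b) (i : ℕ) :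
    tailMass a b i = a i + (b i + tailMass a b (i + 1)) := by
  have h : Summable fun j => a (i + j) + b (i + j) := by
    simp only [add_comm i]
    exact ((summable_nat_add_iff i).2 hsa).add ((summable_nat_add_iff i).2 hsb)
  rw [tailMass, h.tsum_eq_zero_add, tailMass, ← add_assoc]
  simp only [add_zero, add_assoc, add_comm 1]

theorem tailMass_nonneg (ha : ∀ i, 0 < a i) (hb : ∀ i, 0 < b i) (i : ℕ) : 0 ≤ tailMass a b i :=
  tsum_nonneg fun _ => (add_pos (ha _) (hb _)).le

/-- Pairs each b with the following a, the grouping in which the lower bound on q controls the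
terms. -/
theorem add_tailMass_eq (hsa : Summable a) (hsb : Summable b) (i : ℕ) :
    b i + tailMass a b (i + 1) = ∑' j, (a (i + j + 1) + b (i + j)) := by
  have h1 : Summable fun j => a (i + 1 + j) := by
    simp only [add_comm (i + 1)]
    exact (summable_nat_add_iff (i + 1)).2 hsa
  have h2 : Summable fun j => b (i + 1 + j) := by
    simp only [add_comm (i + 1)]
    exact (summable_nat_add_iff (i + 1)).2 hsb
  have h3 : Summable fun j => b (i + j) := by
    simp only [add_comm i]
    exact (summable_nat_add_iff i).2 hsb
  have h4 : ∑' j, (a (i + j + 1) + b (i + j)) = ∑' j, (a (i + 1 + j) + b (i + j)) :=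
    tsum_congr fun j => by rw [add_right_comm]
  rw [h4, tailMass, h1.tsum_add h2, h1.tsum_add h3, h3.tsum_eq_zero_add]
  have h5 : ∑' j, b (i + (j + 1)) = ∑' j, b (i + 1 + j) :=
    tsum_congr fun j => by rw [add_comm j, add_assoc]
  rw [h5, add_zero]
  ring

/-- Geometric decay of the conductances bounds the tails by their leading terms. -/
theorem exists_tailMass_le (ha : ∀ i, 0 < a i) (hb : ∀ i, 0 < b i) (hsa : Summable a)
    (hsb : Summable b) {ρ c : ℝ} (hρ0 : 0 < ρ) (hρ1 : ρ < 1) (hc : 0 < c)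
    (hdecay : ∀ᶠ i in atTop,
      conductance (a (i + 1)) (b (i + 1)) ≤ ρ * conductance (a i) (b i))
    (hlow : ∀ᶠ i in atTop, c * (a (i + 1) + b i) ≤ conductance (a i) (b i)) :
    ∃ C, ∀ i, tailMass a b i ≤ C * a i ∧ b i + tailMass a b (i + 1) ≤ C * b i := by
  obtain ⟨N, hN⟩ := eventually_atTop.1 (hdecay.and hlow)
  -- Each pair a (i+j+1) + b (i+j) is at most 1/c times its conductance; the conductances sum to at
  -- most a geometric series of ratio `ρ`.
  set K : ℝ := 1 / c * (1 - ρ)⁻¹ with hK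
  have h1ρ : 0 < 1 - ρ := by linarith
  have hK0 : 0 < K := by positivity
  have hgeo : ∀ i, N ≤ i → ∀ j,
      conductance (a (i + j)) (b (i + j)) ≤ ρ ^ j * conductance (a i) (b i) := by
    intro i hi j
    induction j with
    | zero => simp
    | succ j ih =>
      refine (hN (i + j) (by omega)).1.trans ?_
      rw [pow_succ', mul_assoc]
      gcongr
  have htail : ∀ i, N ≤ i →
      b i + tailMass a b (i + 1) ≤ K * conductance (a i) (b i) := by
    intro i hi
    rw [add_tailMass_eq hsa hsb]
    have hb1 : ∀ j, a (i + j + 1) + b (i + j) ≤ 1 / c * conductance (a i) (b i) * ρ ^ j := by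
      intro j
      have h1 := ((hN (i + j) (by omega)).2).trans (hgeo i hi j)
      rw [mul_comm c, ← le_div_iff₀ hc] at h1
      refine h1.trans_eq ?_
      ring
    have hs : Summable fun j => 1 / c * conductance (a i) (b i) * ρ ^ j :=
      (summable_geometric_of_lt_one hρ0.le hρ1).mul_left _
    have hs' : Summable fun j => a (i + j + 1) + b (i + j) :=
      Summable.of_nonneg_of_le (fun j => (add_pos (ha _) (hb _)).le) hb1 hs
    refine (hs'.tsum_le_tsum hb1 hs).trans_eq ?_
    rw [tsum_mul_left, tsum_geometric_of_lt_one hρ0.le hρ1, hK]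
    ring
  -- Both ratios are nonnegative, so bounding their sum bounds each. A real sequence that is
  -- eventually bounded above is bounded above, which absorbs the indices below `N`.
  have hev : ∀ i, N ≤ i → tailMass a b i / a i + (b i + tailMass a b (i + 1)) / b i
      ≤ 1 + K + K := by
    intro i hi
    refine add_le_add ?_ ?_
    · rw [div_le_iff₀ (ha i), tailMass_eq hsa hsb]
      have := mul_le_mul_of_nonneg_left (conductance_le_left (ha i) (hb i)) hK0.le
      linarith [htail i hi]
    · rw [div_le_iff₀ (hb i)]
      exact (htail i hi).trans
        (mul_le_mul_of_nonneg_left (conductance_le_right (ha i) (hb i)) hK0.le)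
  obtain ⟨C, hC⟩ := Filter.IsBoundedUnder.bddAbove_range
    (isBoundedUnder_of_eventually_le (eventually_atTop.2 ⟨N, hev⟩))
  refine ⟨C, fun i => ?_⟩
  have hCi := hC ⟨i, rfl⟩
  have hT := tailMass_nonneg ha hb
  have h1 : 0 ≤ tailMass a b i / a i := div_nonneg (hT i) (ha i).le
  have h2 : 0 ≤ (b i + tailMass a b (i + 1)) / b i :=
    div_nonneg (add_nonneg (hb i).le (hT _)) (hb i).le
  exact ⟨(div_le_iff₀ (ha i)).1 (by linarith), (div_le_iff₀ (hb i)).1 (by linarith)⟩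

/-- One edge of the Hardy argument: s, t are adjacent weights, T, U the tail masses from those
vertices, A, B the values there. Since T ≤ Cs, passing from T to U loses a factor 1 - 1/C. Young's
inequality with parameter 1/C costs only 1 + 1/C, and the product 1 - 1/C² is still below 1. -/
theorem one_step_energy_le {C s t T U A B : ℝ} (hC : 1 ≤ C) (hs : 0 < s) (ht : 0 < t)
    (hT : T = s + U) (hTs : T ≤ C * s) (hUt : U ≤ C * t) (htU : t ≤ U) :
    U * B ^ 2 ≤ (1 - 1 / C ^ 2) * (T * A ^ 2)
      + (1 + C) ^ 2 * C * (conductance s t * (B - A) ^ 2) := by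
  have hC0 : 0 < C := by linarith
  have h1 : B ^ 2 ≤ (1 + 1 / C) * A ^ 2 + (1 + C) * (B - A) ^ 2 := by
    have : (1 + 1 / C) * A ^ 2 + (1 + C) * (B - A) ^ 2 - B ^ 2
        = (A - C * (B - A)) ^ 2 / C := by field_simp; ring
    have h2 : 0 ≤ (A - C * (B - A)) ^ 2 / C := by positivity
    linarith
  have h2 : U ≤ (1 - 1 / C) * T := by
    have : T / C ≤ s := by rw [div_le_iff₀ hC0]; linarith
    have e : (1 - 1 / C) * T = T - T / C := by ring
    rw [e]; linarith
  -- Here t ≤ U ≤ T ≤ Cs, so s + t ≤ (1 + C)s.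
  have h3 : t ≤ (1 + C) * conductance s t := by
    unfold conductance
    rw [← mul_div_assoc, le_div_iff₀ (by positivity)]
    nlinarith [mul_pos hs ht]
  have hU : 0 ≤ U := by linarith
  have h4 : U ≤ C * ((1 + C) * conductance s t) :=
    hUt.trans (mul_le_mul_of_nonneg_left h3 hC0.le)
  calc U * B ^ 2 ≤ U * ((1 + 1 / C) * A ^ 2) + U * ((1 + C) * (B - A) ^ 2) := by
        rw [← mul_add]; gcongr
    _ ≤ (1 - 1 / C) * T * ((1 + 1 / C) * A ^ 2)
        + C * ((1 + C) * conductance s t) * ((1 + C) * (B - A) ^ 2) := by gcongr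
    _ = _ := by field_simp; ring

/-- A Poincaré inequality on the path `a 0, b 0, a 1, b 1, …`, for functions vanishing at the
first vertex. -/
theorem path_poincare (ha : ∀ i, 0 < a i) (hb : ∀ i, 0 < b i) (hsa : Summable a)
    (hsb : Summable b) {C : ℝ}
    (hC : ∀ i, tailMass a b i ≤ C * a i ∧ b i + tailMass a b (i + 1) ≤ C * b i)
    {A B : ℕ → ℝ} (hA : IsBdd A) (hB : IsBdd B) (hA0 : A 0 = 0) :
    ∑' i, (a i * A i ^ 2 + b i * B i ^ 2) ≤ C ^ 2 * ((1 + C) ^ 2 * C) *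
      (∑' i, conductance (a i) (b i) * (B i - A i) ^ 2
        + ∑' i, conductance (b i) (a (i + 1)) * (A (i + 1) - B i) ^ 2) := by
  have hT0 := tailMass_nonneg ha hb
  have hTa : ∀ i, a i ≤ tailMass a b i := fun i => by
    rw [tailMass_eq hsa hsb]; linarith [hT0 (i + 1), hb i]
  have hC1 : 1 ≤ C := by
    have := (hTa 0).trans (hC 0).1
    nlinarith [ha 0]
  have hC0 : 0 < C := by linarith
  set T := tailMass a b with hT
  set U : ℕ → ℝ := fun i => b i + T (i + 1) with hU
  have hU0 : ∀ i, 0 ≤ U i := fun i => add_nonneg (hb i).le (hT0 _)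
  have hsT : Summable T := Summable.of_nonneg_of_le hT0 (fun i => (hC i).1) (hsa.mul_left C)
  have hsU : Summable U := Summable.of_nonneg_of_le hU0 (fun i => (hC i).2) (hsb.mul_left C)
  have hsa' : Summable fun i => a (i + 1) := (summable_nat_add_iff 1).2 hsa
  have hs1 : Summable fun i => conductance (a i) (b i) * (B i - A i) ^ 2 :=
    ((hB.sub hA).sq).summable_mul (fun i => conductance_nonneg (ha i) (hb i))
      (Summable.of_nonneg_of_le (fun i => conductance_nonneg (ha i) (hb i))
        (fun i => conductance_le_left (ha i) (hb i)) hsa)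
  have hs2 : Summable fun i => conductance (b i) (a (i + 1)) * (A (i + 1) - B i) ^ 2 :=
    (((hA.comp fun i => i + 1).sub hB).sq).summable_mul
      (fun i => conductance_nonneg (hb i) (ha _))
      (Summable.of_nonneg_of_le (fun i => conductance_nonneg (hb i) (ha _))
        (fun i => conductance_le_left (hb i) (ha _)) hsb)
  have hsTA : Summable fun i => T i * A i ^ 2 := hA.sq.summable_mul hT0 hsT
  have hsUB : Summable fun i => U i * B i ^ 2 := hB.sq.summable_mul hU0 hsU
  have hsTA' : Summable fun i => T (i + 1) * A (i + 1) ^ 2 := (summable_nat_add_iff 1).2 hsTA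
  have hsaA : Summable fun i => a i * A i ^ 2 := hA.sq.summable_mul (fun i => (ha i).le) hsa
  have hsbB : Summable fun i => b i * B i ^ 2 := hB.sq.summable_mul (fun i => (hb i).le) hsb
  -- Vanishing at the first vertex makes the shifted energy equal to the full one, so the two edge
  -- estimates close up on the same pair of sums.
  have e1 : ∑' i, T i * A i ^ 2 = ∑' i, T (i + 1) * A (i + 1) ^ 2 := by
    rw [hsTA.tsum_eq_zero_add, hA0]; simp
  have i1 := hsUB.tsum_le_tsum (fun i => one_step_energy_le (A := A i) (B := B i) hC1 (ha i) (hb i)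
    (tailMass_eq hsa hsb i) (hC i).1 (hC i).2 (by linarith [hT0 (i + 1)]))
    ((hsTA.mul_left _).add (hs1.mul_left _))
  have i2 := hsTA'.tsum_le_tsum (fun i => one_step_energy_le (A := B i) (B := A (i + 1)) hC1 (hb i)
    (ha (i + 1)) (T := U i) rfl (hC i).2 (hC (i + 1)).1 (hTa (i + 1)))
    ((hsUB.mul_left _).add (hs2.mul_left _))
  rw [(hsTA.mul_left _).tsum_add (hs1.mul_left _), tsum_mul_left, tsum_mul_left] at i1
  rw [(hsUB.mul_left _).tsum_add (hs2.mul_left _), tsum_mul_left, tsum_mul_left, ← e1] at i2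
  have i3 : ∑' i, (a i * A i ^ 2 + b i * B i ^ 2) ≤ ∑' i, T i * A i ^ 2 + ∑' i, U i * B i ^ 2 := by
    rw [hsaA.tsum_add hsbB]
    refine add_le_add (hsaA.tsum_le_tsum (fun i => ?_) hsTA) (hsbB.tsum_le_tsum (fun i => ?_) hsUB)
    · exact mul_le_mul_of_nonneg_right (hTa i) (sq_nonneg _)
    · exact mul_le_mul_of_nonneg_right (by linarith [hT0 (i + 1)]) (sq_nonneg _)
  refine i3.trans ?_
  set SA := ∑' i, T i * A i ^ 2
  set SB := ∑' i, U i * B i ^ 2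
  set D1 := ∑' i, conductance (a i) (b i) * (B i - A i) ^ 2
  set D2 := ∑' i, conductance (b i) (a (i + 1)) * (A (i + 1) - B i) ^ 2
  -- Adding `i1` and `i2` puts (1 - 1/C²)(SA + SB) on the right, which is absorbed on the left.
  have i4 : 1 / C ^ 2 * (SA + SB) ≤ (1 + C) ^ 2 * C * (D1 + D2) := by linarith
  have i5 := mul_le_mul_of_nonneg_left i4 (sq_nonneg C)
  calc SA + SB = C ^ 2 * (1 / C ^ 2 * (SA + SB)) := by field_simp
    _ ≤ _ := by rw [mul_assoc]; exact i5

end Tail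

end Path

/-! ### Conditional expectations and energy for the discrete family -/

section Family

/-- The standing assumptions on the two sequences of the discrete family. -/
structure IsFamily (a b : ℕ → ℝ) : Prop where
  a_pos : ∀ i : ℕ, 1 ≤ i → 0 < a i
  b_pos : ∀ i : ℕ, 1 ≤ i → 0 < b i
  b_zero : b 0 = 0
  summable_a : Summable fun i : ℕ+ => a i
  summable_b : Summable fun i : ℕ+ => b i
  tsum_eq : (∑' i : ℕ+, a i) + (∑' i : ℕ+, b i) = 1

/-- Conditional expectation given the second coordinate. -/
noncomputable def condExpX (a b : ℕ → ℝ) (F : ℕ+ × ℕ+ → ℝ) (z : ℕ+ × ℕ+) : ℝ :=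
  (a z.2 * F (z.2, z.2) + b z.2 * F (z.2 + 1, z.2)) / (a z.2 + b z.2)

/-- Conditional expectation given the first coordinate. -/
noncomputable def condExpY (a b : ℕ → ℝ) (F : ℕ+ × ℕ+ → ℝ) (z : ℕ+ × ℕ+) : ℝ :=
  (a z.1 * F (z.1, z.1) + b (z.1 - 1 : ℕ) * F (z.1, z.1 - 1)) / (a z.1 + b (z.1 - 1 : ℕ))

/-- The value of a function at the `i`-th diagonal point of the support. -/
def diag (F : ℕ+ × ℕ+ → ℝ) (i : ℕ) : ℝ := F (i.succPNat, i.succPNat)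

/-- The value of a function at the `i`-th off-diagonal point of the support. -/
def offDiag (F : ℕ+ × ℕ+ → ℝ) (i : ℕ) : ℝ := F ((i + 1).succPNat, i.succPNat)

/-- The mean of a function under the joint distribution. -/
noncomputable def jointMean (a b : ℕ → ℝ) (F : ℕ+ × ℕ+ → ℝ) : ℝ :=
  ∑' i, (a (i + 1) * diag F i + b (i + 1) * offDiag F i)

theorem succPNat_add_one (i : ℕ) : i.succPNat + 1 = (i + 1).succPNat := PNat.eq rfl

theorem succPNat_succ_sub_one (i : ℕ) : (i + 1).succPNat - 1 = i.succPNat :=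
  PNat.eq (by rw [PNat.sub_coe]; simp [← PNat.coe_lt_coe])

theorem exists_eq_succPNat (x : ℕ+) : ∃ i : ℕ, x = i.succPNat :=
  ⟨x.natPred, (PNat.succPNat_natPred x).symm⟩

theorem condExpX_succPNat (a b : ℕ → ℝ) (F : ℕ+ × ℕ+ → ℝ) (x : ℕ+) (i : ℕ) :
    condExpX a b F (x, i.succPNat) =
      (a (i + 1) * diag F i + b (i + 1) * offDiag F i) / (a (i + 1) + b (i + 1)) := by
  simp only [condExpX, succPNat_add_one, diag, offDiag, Nat.succPNat_coe, Nat.succ_eq_add_one]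

theorem condExpY_succPNat_succ (a b : ℕ → ℝ) (F : ℕ+ × ℕ+ → ℝ) (y : ℕ+) (i : ℕ) :
    condExpY a b F ((i + 1).succPNat, y) =
      (a (i + 1 + 1) * diag F (i + 1) + b (i + 1) * offDiag F i)
        / (a (i + 1 + 1) + b (i + 1)) := by
  simp only [condExpY, succPNat_succ_sub_one, diag, offDiag, Nat.succPNat_coe,
    Nat.succ_eq_add_one, Nat.add_sub_cancel]

variable {a b : ℕ → ℝ}

theorem weighted_abs_le {s t u v B : ℝ} (hs : 0 < s) (ht : 0 ≤ t) (hu : |u| ≤ B) (hv : |v| ≤ B) :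
    |(s * u + t * v) / (s + t)| ≤ B := by
  rw [abs_div, abs_of_pos (by positivity : 0 < s + t), div_le_iff₀ (by positivity)]
  refine (abs_add_le _ _).trans ?_
  rw [abs_mul, abs_mul, abs_of_pos hs, abs_of_nonneg ht]
  have h1 := mul_le_mul_of_nonneg_left hu hs.le
  have h2 := mul_le_mul_of_nonneg_left hv ht
  linarith

/-- Variance decomposition for a two-point space: the conductance is the coefficient of the squared
difference. -/
theorem energy_split {s t u v : ℝ} (h : s + t ≠ 0) :
    s * u ^ 2 + t * v ^ 2 = (s * ((s * u + t * v) / (s + t)) ^ 2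
      + t * ((s * u + t * v) / (s + t)) ^ 2) + conductance s t * (v - u) ^ 2 := by
  unfold conductance
  field_simp
  ring

theorem mean_split {s t u v : ℝ} (h : s + t ≠ 0) :
    s * u + t * v = s * ((s * u + t * v) / (s + t)) + t * ((s * u + t * v) / (s + t)) := by
  field_simp

namespace IsFamily

variable (h : IsFamily a b)
include h

theorem a_succ_pos (i : ℕ) : 0 < a (i + 1) := h.a_pos _ (by omega)

theorem b_succ_pos (i : ℕ) : 0 < b (i + 1) := h.b_pos _ (by omega)

theorem a_pnat_pos (x : ℕ+) : 0 < a x := h.a_pos _ x.2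

theorem b_pnat_pos (x : ℕ+) : 0 < b x := h.b_pos _ x.2

theorem b_pred_nonneg (x : ℕ+) : 0 ≤ b ((x : ℕ) - 1) := by
  rcases Nat.eq_zero_or_pos ((x : ℕ) - 1) with hx | hx
  · rw [hx, h.b_zero]
  · exact (h.b_pos _ hx).le

theorem summable_a_succ : Summable fun i => a (i + 1) :=
  Equiv.pnatEquivNat.symm.summable_iff.2 h.summable_a

theorem summable_b_succ : Summable fun i => b (i + 1) :=
  Equiv.pnatEquivNat.symm.summable_iff.2 h.summable_b

theorem summable_diag {F : ℕ+ × ℕ+ → ℝ} (hF : IsBdd F) :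
    Summable fun i => a (i + 1) * diag F i :=
  (hF.comp _).summable_mul (fun i => (h.a_succ_pos i).le) h.summable_a_succ

theorem summable_offDiag {F : ℕ+ × ℕ+ → ℝ} (hF : IsBdd F) :
    Summable fun i => b (i + 1) * offDiag F i :=
  (hF.comp _).summable_mul (fun i => (h.b_succ_pos i).le) h.summable_b_succ

theorem summable_jointMean {F : ℕ+ × ℕ+ → ℝ} (hF : IsBdd F) :
    Summable fun i => a (i + 1) * diag F i + b (i + 1) * offDiag F i :=
  (h.summable_diag hF).add (h.summable_offDiag hF)

theorem jointMean_const (c : ℝ) : jointMean a b (fun _ => c) = c := by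
  have h1 : ∑' i, a (i + 1) = ∑' i : ℕ+, a i := Equiv.pnatEquivNat.symm.tsum_eq fun i : ℕ+ => a i
  have h2 : ∑' i, b (i + 1) = ∑' i : ℕ+, b i := Equiv.pnatEquivNat.symm.tsum_eq fun i : ℕ+ => b i
  simp only [jointMean, diag, offDiag]
  rw [(h.summable_a_succ.mul_right c).tsum_add (h.summable_b_succ.mul_right c), tsum_mul_right,
    tsum_mul_right, h1, h2, ← add_mul, h.tsum_eq, one_mul]

theorem jointMean_add {F G : ℕ+ × ℕ+ → ℝ} (hF : IsBdd F) (hG : IsBdd G) :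
    jointMean a b (fun z => F z + G z) = jointMean a b F + jointMean a b G := by
  unfold jointMean
  rw [← (h.summable_jointMean hF).tsum_add (h.summable_jointMean hG)]
  refine tsum_congr fun i => ?_
  simp only [diag, offDiag]
  ring

omit h in
theorem jointMean_const_mul (c : ℝ) (F : ℕ+ × ℕ+ → ℝ) :
    jointMean a b (fun z => c * F z) = c * jointMean a b F := by
  unfold jointMean
  rw [← tsum_mul_left]
  refine tsum_congr fun i => ?_
  simp only [diag, offDiag]
  ring

theorem jointMean_mono {F G : ℕ+ × ℕ+ → ℝ} (hF : IsBdd F) (hG : IsBdd G) (hFG : ∀ z, F z ≤ G z) :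
    jointMean a b F ≤ jointMean a b G :=
  (h.summable_jointMean hF).tsum_le_tsum (fun i => add_le_add
    (mul_le_mul_of_nonneg_left (hFG _) (h.a_succ_pos i).le)
    (mul_le_mul_of_nonneg_left (hFG _) (h.b_succ_pos i).le)) (h.summable_jointMean hG)

theorem mul_diag_le_jointMean {F : ℕ+ × ℕ+ → ℝ} (hF : IsBdd F) (h0 : ∀ z, 0 ≤ F z) (x : ℕ+) :
    a x * F (x, x) ≤ jointMean a b F := by
  obtain ⟨i, rfl⟩ := exists_eq_succPNat x
  have hn : ∀ j, 0 ≤ a (j + 1) * diag F j + b (j + 1) * offDiag F j := fun j =>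
    add_nonneg (mul_nonneg (h.a_succ_pos j).le (h0 _)) (mul_nonneg (h.b_succ_pos j).le (h0 _))
  refine le_trans ?_ ((h.summable_jointMean hF).le_tsum i fun j _ => hn j)
  exact le_add_of_nonneg_right (mul_nonneg (h.b_succ_pos i).le (h0 _))

/-- Regroups by first coordinate instead of second: the vertex (1,1) stands alone and each
off-diagonal point joins the next diagonal one, which are the blocks of `condExpY`. -/
theorem jointMean_regroup {F : ℕ+ × ℕ+ → ℝ} (hF : IsBdd F) :
    jointMean a b F = a 1 * diag F 0
      + ∑' i, (a (i + 1 + 1) * diag F (i + 1) + b (i + 1) * offDiag F i) := by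
  unfold jointMean
  rw [(h.summable_diag hF).tsum_add (h.summable_offDiag hF),
    (h.summable_diag hF).tsum_eq_zero_add,
    ((summable_nat_add_iff 1).2 (h.summable_diag hF)).tsum_add (h.summable_offDiag hF), add_assoc]

theorem isBdd_condExpX {F : ℕ+ × ℕ+ → ℝ} (hF : IsBdd F) : IsBdd (condExpX a b F) := by
  obtain ⟨B, hB⟩ := hF
  exact ⟨B, fun z => weighted_abs_le (h.a_pnat_pos _) (h.b_pnat_pos _).le (hB _) (hB _)⟩

theorem isBdd_condExpY {F : ℕ+ × ℕ+ → ℝ} (hF : IsBdd F) : IsBdd (condExpY a b F) := by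
  obtain ⟨B, hB⟩ := hF
  exact ⟨B, fun z => weighted_abs_le (h.a_pnat_pos _) (h.b_pred_nonneg _) (hB _) (hB _)⟩

/-- The convention `b 0 = 0` removes the second term, so the truncated value of `1 - 1` in `ℕ+` is
harmless. -/
theorem condExpY_one (F : ℕ+ × ℕ+ → ℝ) (y : ℕ+) : condExpY a b F (1, y) = F (1, 1) := by
  have : a 1 ≠ 0 := (h.a_pos 1 le_rfl).ne'
  simp [condExpY, h.b_zero, this]

theorem condExpY_condExpY (F : ℕ+ × ℕ+ → ℝ) : condExpY a b (condExpY a b F) = condExpY a b F := by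
  funext z
  have hz : a z.1 + b ((z.1 : ℕ) - 1) ≠ 0 :=
    (add_pos_of_pos_of_nonneg (h.a_pnat_pos _) (h.b_pred_nonneg _)).ne'
  simp only [condExpY]
  field_simp

theorem condExpX_const (c : ℝ) : condExpX a b (fun _ => c) = fun _ => c := by
  funext z
  have hz : a z.2 + b z.2 ≠ 0 := (add_pos (h.a_pnat_pos _) (h.b_pnat_pos _)).ne'
  simp only [condExpX]
  field_simp

theorem condExpY_const (c : ℝ) : condExpY a b (fun _ => c) = fun _ => c := by
  funext z
  have hz : a z.1 + b ((z.1 : ℕ) - 1) ≠ 0 :=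
    (add_pos_of_pos_of_nonneg (h.a_pnat_pos _) (h.b_pred_nonneg _)).ne'
  simp only [condExpY]
  field_simp

theorem condExpY_fst (f : ℕ+ → ℝ) :
    condExpY a b (fun z => f z.1) = fun z => f z.1 := by
  funext z
  have hz : a z.1 + b ((z.1 : ℕ) - 1) ≠ 0 :=
    (add_pos_of_pos_of_nonneg (h.a_pnat_pos _) (h.b_pred_nonneg _)).ne'
  simp only [condExpY]
  field_simp

theorem jointMean_condExpX (F : ℕ+ × ℕ+ → ℝ) :
    jointMean a b (condExpX a b F) = jointMean a b F := by
  refine tsum_congr fun i => ?_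
  have hi : a (i + 1) + b (i + 1) ≠ 0 := (add_pos (h.a_succ_pos i) (h.b_succ_pos i)).ne'
  rw [mean_split hi (u := diag F i)]
  simp only [diag, offDiag, condExpX_succPNat]

theorem jointMean_condExpY {F : ℕ+ × ℕ+ → ℝ} (hF : IsBdd F) :
    jointMean a b (condExpY a b F) = jointMean a b F := by
  rw [h.jointMean_regroup (h.isBdd_condExpY hF), h.jointMean_regroup hF]
  congr 1
  · exact congrArg _ (h.condExpY_one F _)
  refine tsum_congr fun i => ?_
  have hi : a (i + 1 + 1) + b (i + 1) ≠ 0 :=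
    (add_pos (h.a_succ_pos (i + 1)) (h.b_succ_pos i)).ne'
  rw [mean_split hi (u := diag F (i + 1))]
  simp only [diag, offDiag, condExpY_succPNat_succ]

theorem summable_conductance_diag {F : ℕ+ × ℕ+ → ℝ} (hF : IsBdd F) :
    Summable fun i => conductance (a (i + 1)) (b (i + 1)) * (offDiag F i - diag F i) ^ 2 :=
  (((hF.comp _).sub (hF.comp _)).sq).summable_mul
    (fun i => conductance_nonneg (h.a_succ_pos i) (h.b_succ_pos i))
    (Summable.of_nonneg_of_le (fun i => conductance_nonneg (h.a_succ_pos i) (h.b_succ_pos i))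
      (fun i => conductance_le_left (h.a_succ_pos i) (h.b_succ_pos i)) h.summable_a_succ)

theorem summable_conductance_offDiag {F : ℕ+ × ℕ+ → ℝ} (hF : IsBdd F) :
    Summable fun i =>
      conductance (b (i + 1)) (a (i + 1 + 1)) * (diag F (i + 1) - offDiag F i) ^ 2 :=
  (((hF.comp _).sub (hF.comp _)).sq).summable_mul
    (fun i => conductance_nonneg (h.b_succ_pos i) (h.a_succ_pos (i + 1)))
    (Summable.of_nonneg_of_le
      (fun i => conductance_nonneg (h.b_succ_pos i) (h.a_succ_pos (i + 1)))
      (fun i => conductance_le_left (h.b_succ_pos i) (h.a_succ_pos (i + 1))) h.summable_b_succ)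

theorem jointMean_sq_eq_condExpX {F : ℕ+ × ℕ+ → ℝ} (hF : IsBdd F) :
    jointMean a b (fun z => F z ^ 2) = jointMean a b (fun z => condExpX a b F z ^ 2)
      + ∑' i, conductance (a (i + 1)) (b (i + 1)) * (offDiag F i - diag F i) ^ 2 := by
  unfold jointMean
  rw [← (h.summable_jointMean (h.isBdd_condExpX hF).sq).tsum_add (h.summable_conductance_diag hF)]
  refine tsum_congr fun i => ?_
  have hi : a (i + 1) + b (i + 1) ≠ 0 := (add_pos (h.a_succ_pos i) (h.b_succ_pos i)).ne'
  refine (energy_split hi).trans ?_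
  simp only [diag, offDiag, condExpX_succPNat]

theorem jointMean_sq_eq_condExpY {F : ℕ+ × ℕ+ → ℝ} (hF : IsBdd F) :
    jointMean a b (fun z => F z ^ 2) = jointMean a b (fun z => condExpY a b F z ^ 2)
      + ∑' i, conductance (b (i + 1)) (a (i + 1 + 1)) * (diag F (i + 1) - offDiag F i) ^ 2 := by
  have hs : Summable fun i => a (i + 1 + 1) * diag (fun z => condExpY a b F z ^ 2) (i + 1)
      + b (i + 1) * offDiag (fun z => condExpY a b F z ^ 2) i :=
    ((summable_nat_add_iff 1).2 (h.summable_diag (h.isBdd_condExpY hF).sq)).add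
      (h.summable_offDiag (h.isBdd_condExpY hF).sq)
  rw [h.jointMean_regroup (h.isBdd_condExpY hF).sq, h.jointMean_regroup hF.sq, add_assoc,
    ← hs.tsum_add (h.summable_conductance_offDiag hF)]
  congr 1
  · exact congrArg (fun t => a 1 * t ^ 2) (h.condExpY_one F _).symm
  refine tsum_congr fun i => ?_
  have hi : b (i + 1) + a (i + 1 + 1) ≠ 0 :=
    (add_pos (h.b_succ_pos i) (h.a_succ_pos (i + 1))).ne'
  -- The edge runs from bᵢ to aᵢ₊₁ in path order, whereas `condExpY` lists the diagonal weight
  -- first.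
  rw [add_comm]
  refine (energy_split hi).trans ?_
  simp only [diag, offDiag, condExpY_succPNat_succ]
  rw [add_comm (a (i + 1 + 1)) (b (i + 1)), add_comm (a (i + 1 + 1) * _) (b (i + 1) * F _)]
  ring

theorem jointMean_sq_condExpX_le {F : ℕ+ × ℕ+ → ℝ} (hF : IsBdd F) :
    jointMean a b (fun z => condExpX a b F z ^ 2) ≤ jointMean a b (fun z => F z ^ 2) := by
  rw [h.jointMean_sq_eq_condExpX hF]
  exact le_add_of_nonneg_right (tsum_nonneg fun i =>
    mul_nonneg (conductance_nonneg (h.a_succ_pos i) (h.b_succ_pos i)) (sq_nonneg _))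

theorem jointMean_sq_condExpY_le {F : ℕ+ × ℕ+ → ℝ} (hF : IsBdd F) :
    jointMean a b (fun z => condExpY a b F z ^ 2) ≤ jointMean a b (fun z => F z ^ 2) := by
  rw [h.jointMean_sq_eq_condExpY hF]
  exact le_add_of_nonneg_right (tsum_nonneg fun i =>
    mul_nonneg (conductance_nonneg (h.b_succ_pos i) (h.a_succ_pos (i + 1))) (sq_nonneg _))

/-- `condExpX` depends only on the second coordinate, so its value at `z` is its value at the
diagonal point of that row, an atom of mass `a z.2`. Hence the bound holds even off the support. -/
theorem sq_condExpX_le {F : ℕ+ × ℕ+ → ℝ} (hF : IsBdd F) (z : ℕ+ × ℕ+) :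
    condExpX a b F z ^ 2 ≤ (a z.2)⁻¹ * jointMean a b (fun z => F z ^ 2) := by
  have h1 := h.mul_diag_le_jointMean (h.isBdd_condExpX hF).sq (fun _ => sq_nonneg _) z.2
  rw [inv_mul_eq_div, le_div_iff₀' (h.a_pnat_pos _)]
  exact h1.trans (h.jointMean_sq_condExpX_le hF)

theorem sq_condExpY_le {F : ℕ+ × ℕ+ → ℝ} (hF : IsBdd F) (z : ℕ+ × ℕ+) :
    condExpY a b F z ^ 2 ≤ (a z.1)⁻¹ * jointMean a b (fun z => F z ^ 2) := by
  have h1 := h.mul_diag_le_jointMean (h.isBdd_condExpY hF).sq (fun _ => sq_nonneg _) z.1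
  rw [inv_mul_eq_div, le_div_iff₀' (h.a_pnat_pos _)]
  exact h1.trans (h.jointMean_sq_condExpY_le hF)

/-- The mean is the best constant approximation in L². This allows recentring at the first vertex,
as `path_poincare` requires. -/
theorem jointMean_sq_le_of_mean_zero {F : ℕ+ × ℕ+ → ℝ} (hF : IsBdd F)
    (hF0 : jointMean a b F = 0) (c : ℝ) :
    jointMean a b (fun z => F z ^ 2) ≤ jointMean a b (fun z => (F z - c) ^ 2) := by
  have hl : IsBdd fun z => (-2 * c) * F z := hF.const_mul _
  have hc : IsBdd fun _ : ℕ+ × ℕ+ => c ^ 2 := ⟨|c ^ 2|, fun _ => le_rfl⟩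
  have hcl : IsBdd fun z => (-2 * c) * F z + c ^ 2 := hl.add hc
  have e : (fun z => (F z - c) ^ 2) = fun z => F z ^ 2 + ((-2 * c) * F z + c ^ 2) := by
    funext z; ring
  rw [e, h.jointMean_add hF.sq hcl, h.jointMean_add hl hc, jointMean_const_mul, hF0,
    h.jointMean_const]
  nlinarith [sq_nonneg c]

/-- The energy of a centred function is controlled by its two conditional variances. -/
theorem jointMean_sq_le {C : ℝ}
    (hC : ∀ i, tailMass (fun i => a (i + 1)) (fun i => b (i + 1)) i ≤ C * a (i + 1) ∧
      b (i + 1) + tailMass (fun i => a (i + 1)) (fun i => b (i + 1)) (i + 1) ≤ C * b (i + 1))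
    {F : ℕ+ × ℕ+ → ℝ} (hF : IsBdd F) (hF0 : jointMean a b F = 0) :
    jointMean a b (fun z => F z ^ 2) ≤ C ^ 2 * ((1 + C) ^ 2 * C) *
      (2 * jointMean a b (fun z => F z ^ 2) - jointMean a b (fun z => condExpX a b F z ^ 2)
        - jointMean a b (fun z => condExpY a b F z ^ 2)) := by
  have hc : IsBdd fun _ : ℕ+ × ℕ+ => diag F 0 := ⟨|diag F 0|, fun _ => le_rfl⟩
  have h1 := path_poincare h.a_succ_pos h.b_succ_pos h.summable_a_succ h.summable_b_succ hC
    (A := diag fun z => F z - diag F 0) (B := offDiag fun z => F z - diag F 0)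
    ((hF.sub hc).comp _) ((hF.sub hc).comp _) (sub_self _)
  have h2 := h.jointMean_sq_eq_condExpX hF
  have h3 := h.jointMean_sq_eq_condExpY hF
  refine (h.jointMean_sq_le_of_mean_zero hF hF0 (diag F 0)).trans (h1.trans_eq ?_)
  -- Differences ignore the subtracted constant, so the Dirichlet form is the energy lost by `F`
  -- itself.
  simp only [diag, offDiag, sub_sub_sub_cancel_right] at h2 h3 ⊢
  congr 1
  linarith

end IsFamily

end Family

/-! ### Kernels given by densities -/

section DensityKernel

variable {S : Type*} [MeasurableSpace S] [DiscreteMeasurableSpace S] [Countable S]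

theorem isMarkovKernel_densityKernel {k : S → S → ℝ} (h0 : ∀ z' z, 0 ≤ k z' z)
    (h1 : ∀ z, HasSum (fun z' => k z' z) 1) : IsMarkovKernel (densityKernel k) :=
  ⟨fun z => isProbabilityMeasure_densityMeasure (fun z' => h0 z' z) (h1 z)⟩

theorem avg_densityKernel {k : S → S → ℝ} (h0 : ∀ z' z, 0 ≤ k z' z) {g : S → ℝ} (hg : IsBdd g)
    {z : S} (h1 : Summable fun z' => k z' z) {v : ℝ} (hv : HasSum (fun z' => k z' z * g z') v) :
    avg (densityKernel k) g z = v :=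
  (integral_densityMeasure (fun z' => h0 z' z) h1 hg).trans hv.tsum_eq

end DensityKernel

/-! ### The samplers expressed through conditional expectations -/

section Samplers

variable {a b : ℕ → ℝ}

theorem familyDensity_self (x : ℕ+) : familyDensity a b x x = a x := if_pos rfl

theorem familyDensity_add_one (y : ℕ+) : familyDensity a b (y + 1) y = b y := by
  have : y + 1 ≠ y := (PNat.lt_add_right y 1).ne'
  simp [familyDensity, this]

theorem familyDensity_eq_zero {x y : ℕ+} (h1 : x ≠ y) (h2 : x ≠ y + 1) :
    familyDensity a b x y = 0 := by simp [familyDensity, h1, h2]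

theorem hasSum_familyDensity_fst (f : ℕ+ → ℝ) (y : ℕ+) :
    HasSum (fun x => familyDensity a b x y * f x) (a y * f y + b y * f (y + 1)) := by
  have hne : y ≠ y + 1 := (PNat.lt_add_right y 1).ne
  have := hasSum_sum_of_ne_finset_zero (L := .unconditional _) (f := fun x => familyDensity a b x y * f x)
    (s := {y, y + 1}) (fun x hx => by
      simp only [Finset.mem_insert, Finset.mem_singleton, not_or] at hx
      rw [familyDensity_eq_zero hx.1 hx.2, zero_mul])
  rwa [Finset.sum_pair hne, familyDensity_self, familyDensity_add_one] at this

theorem hasSum_familyDensity_snd (hb : b 0 = 0) (f : ℕ+ → ℝ) (x : ℕ+) :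
    HasSum (fun y => familyDensity a b x y * f y)
      (a x * f x + b ((x : ℕ) - 1) * f (x - 1)) := by
  obtain ⟨i, rfl⟩ := exists_eq_succPNat x
  rcases i with _ | i
  · have := hasSum_single (L := .unconditional _) (f := fun y => familyDensity a b (Nat.succPNat 0) y * f y)
      (Nat.succPNat 0) (fun y hy => by
        rw [familyDensity_eq_zero hy.symm (PNat.lt_add_left 1 y).ne, zero_mul])
    rw [familyDensity_self] at this
    simpa [hb] using this
  · have hne : (i + 1).succPNat ≠ i.succPNat := by
      rw [← succPNat_add_one]; exact (PNat.lt_add_right _ 1).ne'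
    have := hasSum_sum_of_ne_finset_zero (L := .unconditional _)
      (f := fun y => familyDensity a b (i + 1).succPNat y * f y)
      (s := {(i + 1).succPNat, i.succPNat}) (fun y hy => by
        simp only [Finset.mem_insert, Finset.mem_singleton, not_or] at hy
        rw [familyDensity_eq_zero (Ne.symm hy.1) ?_, zero_mul]
        rw [← succPNat_add_one]
        exact fun hc => hy.2 (add_right_cancel hc).symm)
    rw [Finset.sum_pair hne, familyDensity_self, ← succPNat_add_one, familyDensity_add_one] at this
    rw [succPNat_add_one] at this
    simpa [succPNat_succ_sub_one] using this

theorem margY_familyDensity (y : ℕ+) : margY (familyDensity a b) y = a y + b y := by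
  simpa [margY] using (hasSum_familyDensity_fst (a := a) (b := b) (fun _ => 1) y).tsum_eq

theorem margX_familyDensity (hb : b 0 = 0) (x : ℕ+) :
    margX (familyDensity a b) x = a x + b ((x : ℕ) - 1) := by
  simpa [margX] using (hasSum_familyDensity_snd (a := a) hb (fun _ => 1) x).tsum_eq

theorem hasSum_condX (F : ℕ+ × ℕ+ → ℝ) (z : ℕ+ × ℕ+) :
    HasSum (fun x => condX (familyDensity a b) x z.2 * F (x, z.2)) (condExpX a b F z) := by
  simp only [condX, margY_familyDensity, div_mul_eq_mul_div]
  exact (hasSum_familyDensity_fst (fun x => F (x, z.2)) z.2).div_const _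

theorem hasSum_condY (hb : b 0 = 0) (F : ℕ+ × ℕ+ → ℝ) (z : ℕ+ × ℕ+) :
    HasSum (fun y => condY (familyDensity a b) y z.1 * F (z.1, y)) (condExpY a b F z) := by
  simp only [condY, margX_familyDensity hb, div_mul_eq_mul_div]
  exact (hasSum_familyDensity_snd hb (fun y => F (z.1, y)) z.1).div_const _

/-- From a given state only finitely many are reachable, so the double sum converges for arbitrary
`F` and may be computed over y' first, then x'. -/
theorem hasSum_kDGS (hb : b 0 = 0) (F : ℕ+ × ℕ+ → ℝ) (z : ℕ+ × ℕ+) :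
    HasSum (fun z' => kDGS (familyDensity a b) z' z * F z')
      (condExpX a b (condExpY a b F) z) := by
  have hfin : (Function.support fun z' => kDGS (familyDensity a b) z' z * F z').Finite := by
    refine ((Set.finite_Iic (z.2 + 1)).prod (Set.finite_Iic (z.2 + 1))).subset fun z' hz' => ?_
    have h1 : familyDensity a b z'.1 z.2 ≠ 0 := fun hc => hz' (by simp [kDGS, condX, hc])
    have h2 : familyDensity a b z'.1 z'.2 ≠ 0 := fun hc => hz' (by simp [kDGS, condY, hc])
    have h3 : z'.1 ≤ z.2 + 1 := by
      by_contra hlt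
      refine h1 (familyDensity_eq_zero ?_ ?_) <;> rintro h4 <;> refine hlt ?_ <;> rw [h4]
      exact (PNat.lt_add_right _ _).le
    have h4 : z'.2 ≤ z'.1 := by
      by_contra hlt
      refine h2 (familyDensity_eq_zero ?_ ?_) <;> rintro h5 <;> refine hlt ?_ <;> rw [h5]
      exact (PNat.lt_add_right _ _).le
    exact ⟨h3, h4.trans h3⟩
  have hs : Summable fun z' => kDGS (familyDensity a b) z' z * F z' :=
    summable_of_hasFiniteSupport hfin
  have hfib : ∀ x, HasSum (fun y => kDGS (familyDensity a b) (x, y) z * F (x, y))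
      (condX (familyDensity a b) x z.2 * condExpY a b F (x, z.2)) := fun x => by
    simpa only [kDGS, mul_assoc] using
      (hasSum_condY hb F (x, z.2)).mul_left (condX (familyDensity a b) x z.2)
  have h1 := hs.hasSum.prod_fiberwise hfib
  rw [(hasSum_condX _ z).unique h1]
  exact hs.hasSum

theorem hasSum_kRGS (hb : b 0 = 0) (θ : ℝ) (F : ℕ+ × ℕ+ → ℝ) (z : ℕ+ × ℕ+) :
    HasSum (fun z' => kRGS (familyDensity a b) θ z' z * F z')
      (θ * condExpX a b F z + (1 - θ) * condExpY a b F z) := by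
  have h1 : HasSum (fun z' : ℕ+ × ℕ+ => condX (familyDensity a b) z'.1 z.2
      * (if z'.2 = z.2 then 1 else 0) * F z') (condExpX a b F z) := by
    -- The Kronecker delta restricts the sum to the row through `z`.
    refine ((Prod.mk_left_injective z.2).hasSum_iff fun z' hz' => ?_).1 ?_
    · have : z'.2 ≠ z.2 := fun hc => hz' ⟨z'.1, Prod.ext rfl hc.symm⟩
      simp [this]
    · simpa [Function.comp_def] using hasSum_condX F z
  have h2 : HasSum (fun z' : ℕ+ × ℕ+ => condY (familyDensity a b) z'.2 z.1
      * (if z'.1 = z.1 then 1 else 0) * F z') (condExpY a b F z) := by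
    refine ((Prod.mk_right_injective z.1).hasSum_iff fun z' hz' => ?_).1 ?_
    · have : z'.1 ≠ z.1 := fun hc => hz' ⟨z'.2, Prod.ext hc.symm rfl⟩
      simp [this]
    · simpa [Function.comp_def] using hasSum_condY hb F z
  refine ((h1.mul_left θ).add (h2.mul_left (1 - θ))).congr_fun fun z' => ?_
  simp only [kRGS]
  ring

theorem hasSum_kX (hb : b 0 = 0) (f : ℕ+ → ℝ) (x : ℕ+) :
    HasSum (fun x' => kX (familyDensity a b) x' x * f x')
      (condExpY a b (condExpX a b fun z => f z.1) (x, x)) := by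
  have hk : ∀ x', kX (familyDensity a b) x' x =
      condExpY a b (fun z => condX (familyDensity a b) x' z.2) (x, x) := fun x' => by
    rw [← (hasSum_condY hb _ (x, x)).tsum_eq]
    exact tsum_congr fun y => mul_comm _ _
  have h1 := hasSum_condX (a := a) (b := b) (fun z => f z.1) (x, x)
  have h2 := hasSum_condX (a := a) (b := b) (fun z => f z.1) (x, x - 1)
  have h3 := ((h1.mul_left (a x)).add (h2.mul_left (b ((x : ℕ) - 1)))).div_const
    (a x + b ((x : ℕ) - 1))
  refine h3.congr_fun fun x' => ?_
  rw [hk]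
  simp only [condExpY]
  ring

namespace IsFamily

variable (h : IsFamily a b)
include h

theorem familyDensity_nonneg (x y : ℕ+) : 0 ≤ familyDensity a b x y := by
  unfold familyDensity
  split_ifs
  exacts [(h.a_pnat_pos x).le, (h.b_pnat_pos y).le, le_rfl]

theorem condX_nonneg (x y : ℕ+) : 0 ≤ condX (familyDensity a b) x y :=
  div_nonneg (h.familyDensity_nonneg x y) (tsum_nonneg fun _ => h.familyDensity_nonneg _ _)

theorem condY_nonneg (y x : ℕ+) : 0 ≤ condY (familyDensity a b) y x :=
  div_nonneg (h.familyDensity_nonneg x y) (tsum_nonneg fun _ => h.familyDensity_nonneg _ _)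

theorem kX_nonneg (x' x : ℕ+) : 0 ≤ kX (familyDensity a b) x' x :=
  tsum_nonneg fun _ => mul_nonneg (h.condX_nonneg _ _) (h.condY_nonneg _ _)

theorem kDGS_nonneg (z' z : ℕ+ × ℕ+) : 0 ≤ kDGS (familyDensity a b) z' z :=
  mul_nonneg (h.condX_nonneg _ _) (h.condY_nonneg _ _)

theorem kRGS_nonneg {θ : ℝ} (hθ0 : 0 < θ) (hθ1 : θ < 1) (z' z : ℕ+ × ℕ+) :
    0 ≤ kRGS (familyDensity a b) θ z' z := by
  have h1 := h.condX_nonneg z'.1 z.2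
  have h2 := h.condY_nonneg z'.2 z.1
  have h3 : 0 ≤ 1 - θ := by linarith
  unfold kRGS
  split_ifs <;> simp only [mul_one, mul_zero, add_zero, zero_add] <;> positivity

theorem hasSum_kX_one (x : ℕ+) : HasSum (fun x' => kX (familyDensity a b) x' x) 1 := by
  simpa [h.condExpX_const, h.condExpY_const] using hasSum_kX (a := a) h.b_zero (fun _ => 1) x

theorem hasSum_kDGS_one (z : ℕ+ × ℕ+) :
    HasSum (fun z' => kDGS (familyDensity a b) z' z) 1 := by
  simpa [h.condExpX_const, h.condExpY_const] using hasSum_kDGS (a := a) h.b_zero (fun _ => 1) z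

theorem hasSum_kRGS_one (θ : ℝ) (z : ℕ+ × ℕ+) :
    HasSum (fun z' => kRGS (familyDensity a b) θ z' z) 1 := by
  simpa [h.condExpX_const, h.condExpY_const] using hasSum_kRGS (a := a) h.b_zero θ (fun _ => 1) z

theorem hasSum_familyDensity {F : ℕ+ × ℕ+ → ℝ} (hF : IsBdd F) :
    HasSum (fun z : ℕ+ × ℕ+ => familyDensity a b z.1 z.2 * F z) (jointMean a b F) := by
  have hfib : ∀ (G : ℕ+ × ℕ+ → ℝ) (y : ℕ+),
      HasSum (fun x => familyDensity a b x y * G (x, y))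
        (a y * G (y, y) + b y * G (y + 1, y)) := fun G y =>
    hasSum_familyDensity_fst (fun x => G (x, y)) y
  -- Coordinates are swapped so that the inner sum runs over x at fixed y, producing the pairs a y,
  -- b y of `jointMean`.
  have h1 : Summable fun z : ℕ+ × ℕ+ => familyDensity a b z.2 z.1 := by
    refine (summable_prod_of_nonneg fun z => h.familyDensity_nonneg _ _).2 ⟨fun y => ?_, ?_⟩
    · simpa using (hfib (fun _ => 1) y).summable
    · have : ∀ y, ∑' x, familyDensity a b x y = a y + b y := margY_familyDensity
      simp only [this]
      exact h.summable_a.add h.summable_b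
  have h2 : Summable fun z : ℕ+ × ℕ+ => familyDensity a b z.2 z.1 * F z.swap :=
    (hF.comp _).summable_mul (fun z => h.familyDensity_nonneg _ _) h1
  have h3 := h2.hasSum.prod_fiberwise (hfib F)
  have h4 : HasSum (fun y : ℕ+ => a y * F (y, y) + b y * F (y + 1, y)) (jointMean a b F) := by
    refine Equiv.pnatEquivNat.symm.hasSum_iff.1 ?_
    refine (h.summable_jointMean hF).hasSum.congr_fun fun i => ?_
    rfl
  rw [h4.unique h3]
  exact (Equiv.prodComm ℕ+ ℕ+).hasSum_iff.1 h2.hasSum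

theorem isProbabilityMeasure_jointLaw : IsProbabilityMeasure (jointLaw (familyDensity a b)) := by
  refine isProbabilityMeasure_densityMeasure (fun z => h.familyDensity_nonneg _ _) ?_
  simpa [h.jointMean_const] using h.hasSum_familyDensity (F := fun _ => 1) ⟨1, by simp⟩

theorem integral_jointLaw {F : ℕ+ × ℕ+ → ℝ} (hF : IsBdd F) :
    ∫ z, F z ∂(jointLaw (familyDensity a b)) = jointMean a b F := by
  have h1 : HasSum (fun z : ℕ+ × ℕ+ => familyDensity a b z.1 z.2) 1 := by
    simpa [h.jointMean_const] using h.hasSum_familyDensity (F := fun _ => 1) ⟨1, by simp⟩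
  exact (integral_densityMeasure (fun z => h.familyDensity_nonneg _ _) h1.summable hF).trans
    (h.hasSum_familyDensity hF).tsum_eq

theorem hasSum_margX {f : ℕ+ → ℝ} (hf : IsBdd f) :
    HasSum (fun x => margX (familyDensity a b) x * f x) (jointMean a b fun z => f z.1) := by
  refine (h.hasSum_familyDensity (hf.comp Prod.fst)).prod_fiberwise fun x => ?_
  have := (hasSum_familyDensity_snd (a := a) h.b_zero (fun _ => 1) x).mul_right (f x)
  simpa [margX_familyDensity h.b_zero] using this

theorem margX_nonneg (x : ℕ+) : 0 ≤ margX (familyDensity a b) x :=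
  tsum_nonneg fun _ => h.familyDensity_nonneg _ _

theorem hasSum_margX_one : HasSum (margX (familyDensity a b)) 1 := by
  simpa [h.jointMean_const] using h.hasSum_margX (f := fun _ => 1) ⟨1, by simp⟩

theorem isProbabilityMeasure_margLawX : IsProbabilityMeasure (margLawX (familyDensity a b)) :=
  isProbabilityMeasure_densityMeasure h.margX_nonneg h.hasSum_margX_one

theorem integral_margLawX {f : ℕ+ → ℝ} (hf : IsBdd f) :
    ∫ x, f x ∂(margLawX (familyDensity a b)) = jointMean a b fun z => f z.1 :=
  (integral_densityMeasure h.margX_nonneg h.hasSum_margX_one.summable hf).trans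
    (h.hasSum_margX hf).tsum_eq

theorem avg_PX {f : ℕ+ → ℝ} (hf : IsBdd f) (x : ℕ+) :
    avg (PX (familyDensity a b)) f x = condExpY a b (condExpX a b fun z => f z.1) (x, x) :=
  avg_densityKernel h.kX_nonneg hf (h.hasSum_kX_one x).summable (hasSum_kX h.b_zero f x)

theorem avg_PDGS {F : ℕ+ × ℕ+ → ℝ} (hF : IsBdd F) :
    avg (PDGS (familyDensity a b)) F = condExpX a b (condExpY a b F) :=
  funext fun z => avg_densityKernel h.kDGS_nonneg hF (h.hasSum_kDGS_one z).summable
    (hasSum_kDGS h.b_zero F z)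

theorem avg_PRGS {θ : ℝ} (hθ0 : 0 < θ) (hθ1 : θ < 1) {F : ℕ+ × ℕ+ → ℝ} (hF : IsBdd F) :
    avg (PRGS (familyDensity a b) θ) F
      = fun z => θ * condExpX a b F z + (1 - θ) * condExpY a b F z :=
  funext fun z => avg_densityKernel (h.kRGS_nonneg hθ0 hθ1) hF (h.hasSum_kRGS_one θ z).summable
    (hasSum_kRGS h.b_zero θ F z)

end IsFamily

end Samplers

/-! ### Spectral bound and geometric ergodicity -/

namespace IsFamily

variable {a b : ℕ → ℝ} (h : IsFamily a b)
include h

theorem exists_spectral_bound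
    (hlimsup : limsup (fun x : ℕ => ((pSeq a b x / qSeq a b x : ℝ) : EReal)) atTop < 1)
    (hliminf : 0 < liminf (fun x : ℕ => ((qSeq a b x : ℝ) : EReal)) atTop) :
    ∃ K : ℝ, 1 < K ∧ ∀ F : ℕ+ × ℕ+ → ℝ, IsBdd F → jointMean a b F = 0 →
      jointMean a b (fun z => F z ^ 2) ≤ K *
        (2 * jointMean a b (fun z => F z ^ 2) - jointMean a b (fun z => condExpX a b F z ^ 2)
          - jointMean a b (fun z => condExpY a b F z ^ 2)) := by
  obtain ⟨ρ, hρ1, hρ2⟩ := EReal.lt_iff_exists_real_btwn.1 hlimsup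
  obtain ⟨c, hc1, hc2⟩ := EReal.lt_iff_exists_real_btwn.1 hliminf
  -- Starting at x = 2 avoids the unconstrained value `a 0` and the zero weight `b 0`.
  have hp : ∀ i, pSeq a b (i + 2) = a (i + 1 + 1) * b (i + 1 + 1) /
      ((a (i + 1 + 1) + b (i + 1)) * (a (i + 1 + 1) + b (i + 1 + 1))) := fun i => rfl
  have hq : ∀ i, qSeq a b (i + 2) = a (i + 1) * b (i + 1) /
      ((a (i + 1 + 1) + b (i + 1)) * (a (i + 1) + b (i + 1))) := fun i => rfl
  have hratio : ∀ i, pSeq a b (i + 2) / qSeq a b (i + 2) =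
      conductance (a (i + 1 + 1)) (b (i + 1 + 1)) / conductance (a (i + 1)) (b (i + 1)) := by
    intro i
    have h1 := h.a_succ_pos i
    have h2 := h.b_succ_pos i
    have h3 := h.a_succ_pos (i + 1)
    have h4 := h.b_succ_pos (i + 1)
    rw [hp, hq]
    unfold conductance
    field_simp
  have hcpos : ∀ i, 0 < conductance (a (i + 1)) (b (i + 1)) := fun i => by
    have h1 := h.a_succ_pos i
    have h2 := h.b_succ_pos i
    unfold conductance
    positivity
  have e1 := (tendsto_add_atTop_nat 2).eventually (eventually_lt_of_limsup_lt hρ1)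
  have e2 := (tendsto_add_atTop_nat 2).eventually (eventually_lt_of_lt_liminf hc2)
  simp only [EReal.coe_lt_coe_iff] at e1 e2
  -- `ρ` exceeds some ratio of positive conductances.
  have hρ0 : 0 < ρ := by
    obtain ⟨i, hi⟩ := e1.exists
    rw [hratio] at hi
    exact (div_pos (hcpos (i + 1)) (hcpos i)).trans hi
  obtain ⟨C, hC⟩ := exists_tailMass_le h.a_succ_pos h.b_succ_pos h.summable_a_succ
    h.summable_b_succ hρ0 (by exact_mod_cast hρ2 : ρ < 1) (by exact_mod_cast hc1 : 0 < c)
    (e1.mono fun i hi => by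
      rw [hratio, div_lt_iff₀ (hcpos i)] at hi
      exact hi.le)
    (e2.mono fun i hi => by
      have h1 := h.a_succ_pos i
      have h2 := h.b_succ_pos i
      have h3 := h.a_succ_pos (i + 1)
      have : qSeq a b (i + 2) =
          conductance (a (i + 1)) (b (i + 1)) / (a (i + 1 + 1) + b (i + 1)) := by
        rw [hq]; unfold conductance; field_simp
      rw [this, lt_div_iff₀ (by positivity)] at hi
      exact hi.le)
  have hC0 : 0 ≤ C := by
    have := (tailMass_nonneg h.a_succ_pos h.b_succ_pos 0).trans (hC 0).1
    exact nonneg_of_mul_nonneg_left this (h.a_succ_pos 0)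
  have hK : 0 ≤ C ^ 2 * ((1 + C) ^ 2 * C) := by positivity
  -- Adding 2 forces the constant above 1, so that 1 - 1/K is positive; enlarging it is allowed
  -- because the energy lost is nonnegative.
  refine ⟨C ^ 2 * ((1 + C) ^ 2 * C) + 2, by linarith, fun F hF hF0 => ?_⟩
  refine (h.jointMean_sq_le hC hF hF0).trans (mul_le_mul_of_nonneg_right (by linarith) ?_)
  linarith [h.jointMean_sq_condExpX_le hF, h.jointMean_sq_condExpY_le hF]

theorem jointMean_sq_le_one {F : ℕ+ × ℕ+ → ℝ} (hF : ∀ z, |F z| ≤ 1) :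
    jointMean a b (fun z => F z ^ 2) ≤ 1 :=
  (h.jointMean_mono (IsBdd.sq ⟨1, hF⟩) ⟨1, by simp⟩
    (fun z => (sq_le_one_iff_abs_le_one _).2 (hF z))).trans_eq (h.jointMean_const 1)

omit h in
-- A function fixed by `condExpY` loses nothing to it, so the whole loss guaranteed by the spectral
-- bound falls on `condExpX`.
theorem condExpX_contraction {K : ℝ} (hK1 : 1 < K)
    (hK : ∀ F : ℕ+ × ℕ+ → ℝ, IsBdd F → jointMean a b F = 0 →
      jointMean a b (fun z => F z ^ 2) ≤ K *
        (2 * jointMean a b (fun z => F z ^ 2) - jointMean a b (fun z => condExpX a b F z ^ 2)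
          - jointMean a b (fun z => condExpY a b F z ^ 2)))
    {F : ℕ+ × ℕ+ → ℝ} (hF : IsBdd F) (hF0 : jointMean a b F = 0) (hY : condExpY a b F = F) :
    jointMean a b (fun z => condExpX a b F z ^ 2)
      ≤ (1 - 1 / K) * jointMean a b (fun z => F z ^ 2) := by
  have h1 := hK F hF hF0
  rw [hY] at h1
  have h2 := (div_le_iff₀' (by linarith : 0 < K)).2 h1
  have e : (1 - 1 / K) * jointMean a b (fun z => F z ^ 2) = jointMean a b (fun z => F z ^ 2)
    - jointMean a b (fun z => F z ^ 2) / K := by ring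
  rw [e]
  linarith

theorem jointMean_sq_mix_le {θ : ℝ} (hθ0 : 0 < θ) (hθ1 : θ < 1) {F G : ℕ+ × ℕ+ → ℝ}
    (hF : IsBdd F) (hG : IsBdd G) :
    jointMean a b (fun z => (θ * F z + (1 - θ) * G z) ^ 2)
      ≤ θ * jointMean a b (fun z => F z ^ 2) + (1 - θ) * jointMean a b (fun z => G z ^ 2) := by
  rw [← jointMean_const_mul, ← jointMean_const_mul,
    ← h.jointMean_add (IsBdd.const_mul hF.sq _) (IsBdd.const_mul hG.sq _)]
  refine h.jointMean_mono (IsBdd.add (IsBdd.const_mul hF _) (IsBdd.const_mul hG _)).sq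
    (IsBdd.add (IsBdd.const_mul hF.sq _) (IsBdd.const_mul hG.sq _)) fun z => ?_
  nlinarith [mul_nonneg (mul_nonneg hθ0.le (sub_nonneg.2 hθ1.le)) (sq_nonneg (F z - G z))]

section Ergodic

variable {K : ℝ} (hK1 : 1 < K)
  (hK : ∀ F : ℕ+ × ℕ+ → ℝ, IsBdd F → jointMean a b F = 0 →
    jointMean a b (fun z => F z ^ 2) ≤ K *
      (2 * jointMean a b (fun z => F z ^ 2) - jointMean a b (fun z => condExpX a b F z ^ 2)
        - jointMean a b (fun z => condExpY a b F z ^ 2)))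
include hK1 hK

/-- Lifted to the product, a function of x is fixed by `condExpY`; `condExpX` then contracts it and
the outer `condExpY` does not increase energy. -/
theorem geometricallyErgodic_PX :
    GeometricallyErgodic (PX (familyDensity a b)) (margLawX (familyDensity a b)) := by
  have := h.isProbabilityMeasure_margLawX
  have : IsMarkovKernel (PX (familyDensity a b)) :=
    isMarkovKernel_densityKernel h.kX_nonneg h.hasSum_kX_one
  have hK' : 1 / K < 1 := by rw [div_lt_one (by linarith)]; exact hK1
  have hlift : ∀ f, IsBdd f → (fun z : ℕ+ × ℕ+ => avg (PX (familyDensity a b)) f z.1)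
      = condExpY a b (condExpX a b fun z => f z.1) := fun f hf => funext fun z => h.avg_PX hf z.1
  refine geometricallyErgodic_of_contraction _ _ (fun f => jointMean a b fun z => f z.1 ^ 2)
    (fun x => (a x)⁻¹) (1 - 1 / K) 1 (by linarith) (by
      have : 0 < 1 / K := by positivity
      linarith)
    (fun x => (inv_pos.2 (h.a_pnat_pos x)).le) ?_ ?_ ?_ ?_
  · intro f hf
    have hF : IsBdd fun z : ℕ+ × ℕ+ => f z.1 := hf.comp Prod.fst
    rw [h.integral_margLawX hf.avg, h.integral_margLawX hf, hlift f hf,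
      h.jointMean_condExpY (h.isBdd_condExpX hF), h.jointMean_condExpX]
  · intro f hf hf0
    have hF : IsBdd fun z : ℕ+ × ℕ+ => f z.1 := hf.comp Prod.fst
    rw [h.integral_margLawX hf] at hf0
    have e : (fun z : ℕ+ × ℕ+ => avg (PX (familyDensity a b)) f z.1 ^ 2)
        = fun z => condExpY a b (condExpX a b fun z => f z.1) z ^ 2 :=
      funext fun z => congrArg (· ^ 2) (congrFun (hlift f hf) z)
    rw [e]
    exact (h.jointMean_sq_condExpY_le (h.isBdd_condExpX hF)).trans
      (condExpX_contraction hK1 hK hF hf0 (h.condExpY_fst f))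
  · intro f hf x
    have hF : IsBdd fun z : ℕ+ × ℕ+ => f z.1 := hf.comp Prod.fst
    rw [h.avg_PX hf]
    exact (h.sq_condExpY_le (h.isBdd_condExpX hF) (x, x)).trans
      (mul_le_mul_of_nonneg_left (h.jointMean_sq_condExpX_le hF)
        (inv_pos.2 (h.a_pnat_pos x)).le)
  · exact fun f hf => h.jointMean_sq_le_one fun z => hf z.1

/-- The inner `condExpY` makes the function invariant under itself, by idempotence, so the outer
`condExpX` contracts. -/
theorem geometricallyErgodic_PDGS :
    GeometricallyErgodic (PDGS (familyDensity a b)) (jointLaw (familyDensity a b)) := by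
  have := h.isProbabilityMeasure_jointLaw
  have : IsMarkovKernel (PDGS (familyDensity a b)) :=
    isMarkovKernel_densityKernel h.kDGS_nonneg h.hasSum_kDGS_one
  have hK' : 1 / K < 1 := by rw [div_lt_one (by linarith)]; exact hK1
  refine geometricallyErgodic_of_contraction _ _ (fun F => jointMean a b fun z => F z ^ 2)
    (fun z => (a z.2)⁻¹) (1 - 1 / K) 1 (by linarith) (by
      have : 0 < 1 / K := by positivity
      linarith)
    (fun z => (inv_pos.2 (h.a_pnat_pos z.2)).le) ?_ ?_ ?_ (fun F hF => h.jointMean_sq_le_one hF)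
  · intro F hF
    rw [h.integral_jointLaw hF.avg, h.integral_jointLaw hF, h.avg_PDGS hF,
      h.jointMean_condExpX, h.jointMean_condExpY hF]
  · intro F hF hF0
    rw [h.integral_jointLaw hF, ← h.jointMean_condExpY hF] at hF0
    rw [h.avg_PDGS hF]
    exact (condExpX_contraction hK1 hK (h.isBdd_condExpY hF) hF0 (h.condExpY_condExpY F)).trans
      (mul_le_mul_of_nonneg_left (h.jointMean_sq_condExpY_le hF) (by linarith))
  · intro F hF z
    rw [h.avg_PDGS hF]
    exact (h.sq_condExpX_le (h.isBdd_condExpY hF) z).trans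
      (mul_le_mul_of_nonneg_left (h.jointMean_sq_condExpY_le hF)
        (inv_pos.2 (h.a_pnat_pos z.2)).le)

theorem geometricallyErgodic_PRGS {θ : ℝ} (hθ0 : 0 < θ) (hθ1 : θ < 1) :
    GeometricallyErgodic (PRGS (familyDensity a b) θ) (jointLaw (familyDensity a b)) := by
  have := h.isProbabilityMeasure_jointLaw
  have : IsMarkovKernel (PRGS (familyDensity a b) θ) :=
    isMarkovKernel_densityKernel (h.kRGS_nonneg hθ0 hθ1) (h.hasSum_kRGS_one θ)
  have hK0 : 0 < K := by linarith
  have hK' : 1 / K < 1 := by rw [div_lt_one hK0]; exact hK1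
  -- By convexity the mixture loses at least θ and 1 - θ times the two separate losses, hence at
  -- least `m` times their sum, which is at least 1/K of the energy.
  obtain ⟨m, hm0, hmθ, hmθ'⟩ : ∃ m, 0 < m ∧ m ≤ θ ∧ m ≤ 1 - θ :=
    ⟨min θ (1 - θ), lt_min hθ0 (sub_pos.2 hθ1), min_le_left _ _, min_le_right _ _⟩
  have hmK : 0 < m * (1 / K) := by positivity
  have hmK' : m * (1 / K) < 1 := by nlinarith
  refine geometricallyErgodic_of_contraction _ _ (fun F => jointMean a b fun z => F z ^ 2)
    (fun z => θ * (a z.2)⁻¹ + (1 - θ) * (a z.1)⁻¹) (1 - m * (1 / K)) 1 (by linarith)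
    (by linarith) (fun z => ?_) ?_ ?_ ?_ (fun F hF => h.jointMean_sq_le_one hF)
  · have h1 := h.a_pnat_pos z.1
    have h2 := h.a_pnat_pos z.2
    have h3 : 0 ≤ 1 - θ := by linarith
    positivity
  · intro F hF
    rw [h.integral_jointLaw hF.avg, h.integral_jointLaw hF, h.avg_PRGS hθ0 hθ1 hF,
      h.jointMean_add (IsBdd.const_mul (h.isBdd_condExpX hF) _) (IsBdd.const_mul (h.isBdd_condExpY hF) _),
      jointMean_const_mul, jointMean_const_mul, h.jointMean_condExpX, h.jointMean_condExpY hF]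
    ring
  · intro F hF hF0
    rw [h.integral_jointLaw hF] at hF0
    rw [h.avg_PRGS hθ0 hθ1 hF]
    refine (h.jointMean_sq_mix_le hθ0 hθ1 (h.isBdd_condExpX hF) (h.isBdd_condExpY hF)).trans ?_
    have h1 := (div_le_iff₀' hK0).2 (hK F hF hF0)
    have h2 := h.jointMean_sq_condExpX_le hF
    have h3 := h.jointMean_sq_condExpY_le hF
    set q := jointMean a b fun z => F z ^ 2
    set q1 := jointMean a b fun z => condExpX a b F z ^ 2
    set q2 := jointMean a b fun z => condExpY a b F z ^ 2
    have h4 : m * (q - q1) ≤ θ * (q - q1) := mul_le_mul_of_nonneg_right hmθ (by linarith)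
    have h5 : m * (q - q2) ≤ (1 - θ) * (q - q2) := mul_le_mul_of_nonneg_right hmθ' (by linarith)
    have h6 := mul_le_mul_of_nonneg_left h1 hm0.le
    have e : (1 - m * (1 / K)) * q = q - m * (q / K) := by ring
    rw [e]
    linarith
  · intro F hF z
    rw [h.avg_PRGS hθ0 hθ1 hF]
    have h1 := mul_le_mul_of_nonneg_left (h.sq_condExpX_le hF z) hθ0.le
    have h2 := mul_le_mul_of_nonneg_left (h.sq_condExpY_le hF z) (sub_nonneg.2 hθ1.le)
    -- Convexity of the square, whose defect is θ(1 - θ) times the squared difference.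
    nlinarith [mul_nonneg (mul_nonneg hθ0.le (sub_nonneg.2 hθ1.le))
      (sq_nonneg (condExpX a b F z - condExpY a b F z))]

end Ergodic

end IsFamily

end Gibbs

theorem mainTheorem4 (a b : ℕ → ℝ)
    (ha : ∀ i : ℕ, 1 ≤ i → 0 < a i) (hb : ∀ i : ℕ, 1 ≤ i → 0 < b i) (hb0 : b 0 = 0)
    (hsa : Summable fun i : ℕ+ => a i) (hsb : Summable fun i : ℕ+ => b i)
    (hsum : (∑' i : ℕ+, a i) + (∑' i : ℕ+, b i) = 1)
    (hlimsup : limsup (fun x : ℕ => ((Gibbs.pSeq a b x / Gibbs.qSeq a b x : ℝ) : EReal)) atTop < 1)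
    (hliminf : 0 < liminf (fun x : ℕ => ((Gibbs.qSeq a b x : ℝ) : EReal)) atTop)
    (θ : ℝ) (hθ0 : 0 < θ) (hθ1 : θ < 1) :
    Gibbs.GeometricallyErgodic (Gibbs.PX (Gibbs.familyDensity a b))
        (Gibbs.margLawX (Gibbs.familyDensity a b)) ∧
      Gibbs.GeometricallyErgodic (Gibbs.PDGS (Gibbs.familyDensity a b))
        (Gibbs.jointLaw (Gibbs.familyDensity a b)) ∧
      Gibbs.GeometricallyErgodic (Gibbs.PRGS (Gibbs.familyDensity a b) θ)
        (Gibbs.jointLaw (Gibbs.familyDensity a b)) := by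
  have h : Gibbs.IsFamily a b := ⟨ha, hb, hb0, hsa, hsb, hsum⟩
  obtain ⟨K, hK1, hK⟩ := h.exists_spectral_bound hlimsup hliminf
  exact ⟨h.geometricallyErgodic_PX hK1 hK, h.geometricallyErgodic_PDGS hK1 hK,
    h.geometricallyErgodic_PRGS hK1 hK hθ0 hθ1⟩
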